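/- Let $\Bbbk$ be a field, $n\ge 0$, $\mathcal P=\Bbbk[x_1,\dots,x_n]$ with its standard grading, and let $\mathcal I\lhd\mathcal P$ be a homogeneous proper ideal of dimension $D$, i.e. $\dim(\mathcal P/\mathcal I)=D$ (Krull dimension). Let $\mathrm{lt}(\mathcal I)$ be the ideal generated by the leading terms of the nonzero elements of $\mathcal I$ with respect to the degree reverse lexicographic order with $x_1\succ x_2\succ\cdots\succ x_n$. The ideal $\mathcal I$ is in *Noether position* if the last $D$ variables $x_{n-D+1},\dots,x_n$ induce a Noether normalisation of $\mathcal P/\mathcal I$, i.e. the canonical homomorphism $\Bbbk[x_{n-D+1},\dots,x_n]\to\mathcal P/\mathcal I$ is injective and makes $\mathcal P/\mathcal I$ a finite module. For a non-constant term $x^\mu$ let $\mathrm m(x^\mu)$ be the maximal index $m$ with $\mu_m\neq 0$, and set $\mathrm m(1)=1$. A monomial ideal $\mathcal J$, with $q$ the maximal degree of a minimal generator of $\mathcal J$, is *weakly $\ell$-quasi-stable* if for every term $x^\mu\in\mathcal J$ with $m=\mathrm m(x^\mu)\ge n-\ell$ and every index $j<m$ with $1\le j\le n-\ell$ the term $x_j^{q}\,x^\mu/x_m^{\mu_m}$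 lies in $\mathcal J$ (for $\mathcal J=0$ the condition is void). The ideal $\mathcal I$ is in *weakly $\ell$-quasi-stable position* if $\mathrm{lt}(\mathcal I)$ is weakly $\ell$-quasi-stable. **Theorem.** $\mathcal I$ is in Noether position if and only if it is in weakly $D$-quasi-stable position. -/

import Mathlib

/-! Throughout, the polynomial ring in the variables `x₁, …, xₙ` is `MvPolynomial (Fin n) k`; the
variable with 1-based index `i + 1` is `X i` for `i : Fin n`. -/

/-- Exponent vectors of `n` variables, to be ordered degree reverse lexicographically. -/
def DegRevLex (n : ℕ) : Type := Fin n →₀ ℕ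

namespace DegRevLex

variable {n : ℕ}

noncomputable instance : AddCommMonoid (DegRevLex n) :=
  inferInstanceAs (AddCommMonoid (Fin n →₀ ℕ))

/-- The key by which exponent vectors are compared: first the total degree, then the reversed
colexicographic order.  See `degRevLex_lt_iff` for the explicit description. -/
noncomputable def key (a : DegRevLex n) : ℕ ×ₗ (Colex (Fin n →₀ ℕ))ᵒᵈ :=
  toLex (Finsupp.degree (show Fin n →₀ ℕ from a),
    OrderDual.toDual (toColex (show Fin n →₀ ℕ from a)))

theorem key_injective : Function.Injective (key (n := n)) := by
  intro a b h
  have := congrArg (fun p => ofColex (OrderDual.ofDual (ofLex p).2)) h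
  exact this

noncomputable instance : LinearOrder (DegRevLex n) := LinearOrder.lift' key key_injective

theorem lt_iff {a b : DegRevLex n} :
    a < b ↔ Finsupp.degree (show Fin n →₀ ℕ from a) < Finsupp.degree (show Fin n →₀ ℕ from b) ∨
      (Finsupp.degree (show Fin n →₀ ℕ from a) = Finsupp.degree (show Fin n →₀ ℕ from b) ∧
        toColex (show Fin n →₀ ℕ from b) < toColex (show Fin n →₀ ℕ from a)) := by
  change key a < key b ↔ _
  rw [Prod.Lex.lt_iff]
  rfl

theorem add_lt_add {a b : DegRevLex n} (h : a < b) (c : DegRevLex n) : a + c < b + c := by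
  rw [lt_iff] at h ⊢
  have e : ∀ u : DegRevLex n, Finsupp.degree (show Fin n →₀ ℕ from u + c) =
      Finsupp.degree (show Fin n →₀ ℕ from u) + Finsupp.degree (show Fin n →₀ ℕ from c) :=
    fun u => map_add Finsupp.degree (show Fin n →₀ ℕ from u) (show Fin n →₀ ℕ from c)
  rw [e a, e b]
  rcases h with h | ⟨h, h'⟩
  · left; omega
  · refine Or.inr ⟨by omega, ?_⟩
    rw [Finsupp.Colex.lt_iff] at h' ⊢
    obtain ⟨i, hi, hlt⟩ := h'
    refine ⟨i, fun j hj => ?_, ?_⟩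
    · exact congrArg (· + (show Fin n →₀ ℕ from c) j) (hi j hj)
    · exact Nat.add_lt_add_right hlt _

instance : IsOrderedAddMonoid (DegRevLex n) where
  add_le_add_left a b h c := by
    rcases eq_or_lt_of_le h with rfl | h
    · exact le_rfl
    · exact (add_lt_add h c).le

/-- The identity map to `DegRevLex n`. -/
noncomputable def ofExponent (n : ℕ) : (Fin n →₀ ℕ) ≃+ DegRevLex n := AddEquiv.refl _

theorem ofExponent_monotone : Monotone (ofExponent n) := by
  intro a b h
  rcases eq_or_lt_of_le h with rfl | h
  · exact le_rfl
  · refine le_of_lt (lt_iff.2 (Or.inl ?_))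
    obtain ⟨c, rfl⟩ := exists_add_of_le h.le
    have hc : c ≠ 0 := by rintro rfl; simp at h
    change a.degree < (a + c).degree
    rw [map_add]
    have : c.degree ≠ 0 := by rwa [Ne, Finsupp.degree_eq_zero_iff]
    omega

instance : WellFoundedLT (DegRevLex n) := by
  have : WellQuasiOrderedLE (DegRevLex n) := by
    refine ⟨fun f => ?_⟩
    obtain ⟨i, j, hij, h⟩ := wellQuasiOrdered_le (α := Fin n →₀ ℕ) f
    exact ⟨i, j, hij, ofExponent_monotone h⟩
  infer_instance

end DegRevLex

/-- The degree reverse lexicographic order with `X 0 ≻ X 1 ≻ ⋯ ≻ X (n - 1)`. -/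
noncomputable def degRevLex (n : ℕ) : MonomialOrder (Fin n) where
  syn := DegRevLex n
  toSyn := DegRevLex.ofExponent n
  toSyn_monotone := DegRevLex.ofExponent_monotone

/-- `x^a ≺ x^b` iff `deg x^a < deg x^b`, or the degrees agree and at the last index where the
exponents differ `a` has the larger one. -/
theorem degRevLex_lt_iff {n : ℕ} {a b : Fin n →₀ ℕ} :
    (degRevLex n).toSyn a < (degRevLex n).toSyn b ↔
      a.degree < b.degree ∨
        (a.degree = b.degree ∧ ∃ i, (∀ j, i < j → a j = b j) ∧ b i < a i) := by
  refine DegRevLex.lt_iff.trans (or_congr Iff.rfl (and_congr Iff.rfl ?_))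
  rw [Finsupp.Colex.lt_iff]
  constructor
  · rintro ⟨i, h, h'⟩
    exact ⟨i, fun j hj => (h j hj).symm, h'⟩
  · rintro ⟨i, h, h'⟩
    exact ⟨i, fun j hj => (h j hj).symm, h'⟩

section Ideals

open MvPolynomial

/-- The leading ideal of `I`: the ideal generated by the leading terms of the nonzero elements
of `I` with respect to the term order `m`. -/
noncomputable def leadingIdeal {k : Type*} [Field k] {n : ℕ} (m : MonomialOrder (Fin n))
    (I : Ideal (MvPolynomial (Fin n) k)) : Ideal (MvPolynomial (Fin n) k) :=
  Ideal.span {t | ∃ f ∈ I, f ≠ 0 ∧ t = monomial (m.degree f) 1}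

/-- The exponents of the minimal generators of a monomial ideal `J`: the exponents of the terms in
`J` that are minimal for divisibility. -/
def minimalExponents {k : Type*} [Field k] {n : ℕ} (J : Ideal (MvPolynomial (Fin n) k)) :
    Set (Fin n →₀ ℕ) :=
  {μ | Minimal (fun ν : Fin n →₀ ℕ => monomial ν (1 : k) ∈ J) μ}

theorem finite_minimalExponents {k : Type*} [Field k] {n : ℕ}
    (J : Ideal (MvPolynomial (Fin n) k)) : (minimalExponents J).Finite :=
  WellQuasiOrderedLE.finite_of_isAntichain (setOfPred_minimal_antichain _)

/-- The maximal degree of a minimal generator of the monomial ideal `J`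
(a maximum over a finite set by `finite_minimalExponents`; it is `0` for `J = 0`). -/
noncomputable def maxGeneratorDegree {k : Type*} [Field k] {n : ℕ}
    (J : Ideal (MvPolynomial (Fin n) k)) : ℕ :=
  sSup (Finsupp.degree '' minimalExponents J)

/-- Weak `ℓ`-quasi-stability of a monomial ideal `J`.  With `q` the maximal degree of a minimal
generator: for every term `x^μ ∈ J` such that the maximal (1-based) index `m + 1` of a variable
occurring in `x^μ` is at least `n - ℓ`, and every (1-based) index `j + 1 < m + 1` with
`j + 1 ≤ n - ℓ`, the term `x_j^q x^μ / x_m^{μ_m}` lies in `J`. (For the term `1` the condition is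
void.) -/
def IsWeaklyQuasiStable {k : Type*} [Field k] {n : ℕ} (ℓ : ℕ)
    (J : Ideal (MvPolynomial (Fin n) k)) : Prop :=
  ∀ (μ : Fin n →₀ ℕ) (m j : Fin n), monomial μ (1 : k) ∈ J →
    IsGreatest {i : Fin n | μ i ≠ 0} m → n ≤ (m.val + 1) + ℓ →
    j < m → (j.val + 1) + ℓ ≤ n →
    monomial (Finsupp.single j (maxGeneratorDegree J) + μ.erase m) (1 : k) ∈ J

/-- `I` is in weakly `ℓ`-quasi-stable position for the degree reverse lexicographic order if its
leading ideal is weakly `ℓ`-quasi-stable. -/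
def IsInWeaklyQuasiStablePosition {k : Type*} [Field k] {n : ℕ} (ℓ : ℕ)
    (I : Ideal (MvPolynomial (Fin n) k)) : Prop :=
  IsWeaklyQuasiStable ℓ (leadingIdeal (degRevLex n) I)

/-- The canonical `k`-algebra homomorphism `k[x_{n-D+1}, …, x_n] → k[x₁, …, xₙ] ⧸ I` from the
polynomial ring in the last `D` variables. -/
noncomputable def lastVariablesMap {k : Type*} [Field k] {n : ℕ} (D : ℕ)
    (I : Ideal (MvPolynomial (Fin n) k)) :
    MvPolynomial {i : Fin n // n ≤ i.val + D} k →ₐ[k] (MvPolynomial (Fin n) k ⧸ I) :=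
  (Ideal.Quotient.mkₐ k I).comp (rename Subtype.val)

/-- The `D`-dimensional ideal `I` is in Noether position: the last `D` variables induce a Noether
normalisation of `k[x₁, …, xₙ] ⧸ I`, i.e. they are algebraically independent modulo `I` and the
quotient is a finite module over the polynomial ring that they generate. -/
def IsInNoetherPosition {k : Type*} [Field k] {n : ℕ} (D : ℕ)
    (I : Ideal (MvPolynomial (Fin n) k)) : Prop :=
  Function.Injective (lastVariablesMap D I) ∧ (lastVariablesMap D I).Finite

end Ideals

-- The standard grading of the polynomial ring, with respect to which ideals are homogeneous.
attribute [local instance] MvPolynomial.gradedAlgebra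

/-!
# Noether position and weak quasi-stability

Put `A = k[x₁, …, xₙ] ⧸ I`, let `D` be its dimension, and let `J` be the leading ideal of `I` for
the degree reverse lexicographic order. Both properties are equivalent to the condition that `J`
contains a power of every `x_j` that is not among the last `D` variables.

*Noether position.* If `A` is finite over the last `D` variables, then `x_j` satisfies an integral
equation over them. By homogeneity, the part of this equation of total degree equal to the degree
of the equation lies in `I`. It is a power of `x_j` plus terms containing a last variable, which
are smaller in the degree reverse lexicographic order, so `J` contains this power
(`exists_monomial_single_mem_leadingIdeal_of_finite`). Conversely, `A` is spanned by the terms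
outside `J`. If these have bounded exponents in the first `n - D` variables, then finitely many of
them generate `A` over the last variables (`lastVariablesMap_finite_of_monomial_single_mem`).
Injectivity is then automatic: a finite extension of a proper quotient of the polynomial ring in
`D` variables has dimension less than `D`
(`MvPolynomial.injective_of_isIntegral_of_natCard_le_ringKrullDim`).

*Quasi-stability.* If `J` contains a power of `x_j`, then it contains `x_j ^ q`, `q` being the
maximal degree of a minimal generator, so the terms required by weak quasi-stability are multiples
of an element of `J`. Conversely, the `D + 1` variables consisting of `x_j` and the last `D` ones
are algebraically dependent modulo `I` (`natCard_le_ringKrullDim_of_algebraicIndependent`). The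
leading term of such a dependence lies in `J` and contains only these variables
(`exists_monomial_mem_leadingIdeal_of_ringKrullDim`), and weak quasi-stability removes the last
variables from it one at a time, leaving a power of `x_j`
(`IsWeaklyQuasiStable.exists_monomial_single_mem`).
-/

/-! ### Krull dimension of finitely generated algebras -/

section Dimension

open MvPolynomial

/-- Incomparability: along an integral ring homomorphism the dimension does not increase. -/
theorem RingHom.IsIntegral.ringKrullDim_le {R S : Type*} [CommRing R] [CommRing S] {f : R →+* S}
    (hf : f.IsIntegral) : ringKrullDim S ≤ ringKrullDim R := by
  algebraize [f]
  refine Order.krullDim_le_of_strictMono (PrimeSpectrum.comap (algebraMap R S)) fun p q hpq => ?_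
  exact Ideal.IsIntegral.comap_lt_comap hpq

/-- Lying over and going up: along an injective integral ring homomorphism the dimension does not
decrease. -/
theorem RingHom.IsIntegral.le_ringKrullDim {R S : Type*} [CommRing R] [CommRing S] {f : R →+* S}
    (hf : f.IsIntegral) (hinj : Function.Injective f) : ringKrullDim R ≤ ringKrullDim S := by
  algebraize [f]
  refine iSup_le fun l => ?_
  obtain ⟨Q, -, hQ, hQl⟩ := Ideal.exists_ideal_over_prime_of_isIntegral (S := S) l.head.asIdeal ⊥
    (by rw [Ideal.comap_bot_of_injective (algebraMap R S) hinj]; exact bot_le)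
  have : Q.LiesOver l.head.asIdeal := ⟨hQl.symm⟩
  obtain ⟨L, hL, -⟩ := Ideal.exists_ltSeries_of_hasGoingUp l Q
  rw [← hL]
  exact Order.LTSeries.length_le_krullDim L

/-- A finitely generated domain over a field that contains `card ι` algebraically independent
elements has dimension at least `card ι`. -/
theorem natCard_le_ringKrullDim_of_algebraicIndependent_of_isDomain {k B : Type*} [Field k]
    [CommRing B] [IsDomain B] [Algebra k B] [Algebra.FiniteType k B] {ι : Type*} [Finite ι]
    {y : ι → B} (hy : AlgebraicIndependent k y) : (Nat.card ι : WithBot ℕ∞) ≤ ringKrullDim B := by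
  obtain ⟨s, g, hg, hint⟩ := exists_integral_inj_algHom_of_fg k B
  have hs : ringKrullDim (MvPolynomial (Fin s) k) = s := by simp
  refine le_trans ?_ (hs ▸ hint.le_ringKrullDim hg)
  set x : Fin s → B := fun i => g (X i)
  have hrange : g.range = Algebra.adjoin k (Set.range x) := by
    rw [← Algebra.map_top, ← adjoin_range_X, AlgHom.map_adjoin, ← Set.range_comp]
    rfl
  have halg : Algebra.IsAlgebraic (Algebra.adjoin k (Set.range x)) B := by
    rw [← hrange]
    have : Algebra.IsIntegral g.range B := ⟨fun b => by
      obtain ⟨p, hp, hpb⟩ := hint b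
      refine ⟨p.map g.rangeRestrict.toRingHom, hp.map _, ?_⟩
      rw [Polynomial.eval₂_map]
      exact hpb⟩
    infer_instance
  have h1 := Algebra.IsAlgebraic.trdeg_le_cardinalMk k (Set.range x)
  have h2 : Cardinal.mk (Set.range x) ≤ (s : Cardinal) := by
    have := Cardinal.mk_range_le_lift (f := x)
    simpa using this
  have h3 := hy.lift_cardinalMk_le_trdeg.trans (Cardinal.lift_le.2 (h1.trans h2))
  have := Fintype.ofFinite ι
  rw [Nat.card_eq_fintype_card]
  simp only [Cardinal.mk_fintype, Cardinal.lift_natCast, Nat.cast_le] at h3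
  exact_mod_cast h3

/-- The independent elements stay independent modulo a prime that contracts to zero in the
polynomial ring they generate, which reduces the claim to the case of a domain. -/
theorem natCard_le_ringKrullDim_of_algebraicIndependent {k A : Type*} [Field k]
    [CommRing A] [Algebra k A] [Algebra.FiniteType k A] {ι : Type*} [Finite ι]
    {y : ι → A} (hy : AlgebraicIndependent k y) : (Nat.card ι : WithBot ℕ∞) ≤ ringKrullDim A := by
  obtain ⟨p, hp, hpc⟩ := Ideal.exists_comap_eq_of_mem_minimalPrimes_of_injective
    (f := (aeval (R := k) y).toRingHom) hy ⊥ (by simp [IsDomain.minimalPrimes_eq_singleton_bot])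
  have hq : AlgebraicIndependent k fun i => Ideal.Quotient.mkₐ k p (y i) := by
    rw [algebraicIndependent_iff_injective_aeval, injective_iff_map_eq_zero]
    intro f hf
    have : aeval (fun i => Ideal.Quotient.mkₐ k p (y i)) f
        = Ideal.Quotient.mkₐ k p (aeval y f) := by
      rw [← AlgHom.comp_apply, comp_aeval]
    rw [this, Ideal.Quotient.mkₐ_eq_mk, Ideal.Quotient.eq_zero_iff_mem] at hf
    have : f ∈ p.comap (aeval (R := k) y).toRingHom := hf
    rwa [hpc, Ideal.mem_bot] at this
  exact (natCard_le_ringKrullDim_of_algebraicIndependent_of_isDomain hq).trans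
    (ringKrullDim_quotient_le p)

/-- A kernel would make the dimension of the image drop below the number of variables. -/
theorem MvPolynomial.injective_of_isIntegral_of_natCard_le_ringKrullDim {k A : Type*} [Field k]
    [CommRing A] {ι : Type*} [Finite ι] {f : MvPolynomial ι k →+* A} (hf : f.IsIntegral)
    (hdim : (Nat.card ι : WithBot ℕ∞) ≤ ringKrullDim A) : Function.Injective f := by
  rw [injective_iff_map_eq_zero]
  intro r hr
  by_contra h0
  have h1 := ringKrullDim_succ_le_of_surjective f.rangeRestrict f.rangeRestrict_surjective
    (mem_nonZeroDivisors_of_ne_zero h0) (Subtype.ext hr)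
  have hint : f.range.subtype.IsIntegral := by
    refine RingHom.IsIntegral.tower_top f.rangeRestrict f.range.subtype ?_
    exact hf
  have h2 := hdim.trans hint.ringKrullDim_le
  have h3 : ringKrullDim (MvPolynomial ι k) = Nat.card ι := by simp
  rw [h3] at h1
  have h4 : ((Nat.card ι : WithBot ℕ∞)) + 1 ≤ Nat.card ι := le_trans (by gcongr) h1
  have h5 : Nat.card ι + 1 ≤ Nat.card ι := by exact_mod_cast h4
  omega

end Dimension

/-! ### Terms in monomial ideals and leading ideals -/

section Terms

open MvPolynomial

theorem monomial_mem_of_le {k : Type*} [Field k] {n : ℕ} {J : Ideal (MvPolynomial (Fin n) k)}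
    {a b : Fin n →₀ ℕ} (ha : monomial a (1 : k) ∈ J) (hab : a ≤ b) :
    monomial b (1 : k) ∈ J := by
  have : monomial b (1 : k) = monomial (b - a) 1 * monomial a 1 := by
    rw [monomial_mul, one_mul, tsub_add_cancel_of_le hab]
  rw [this]
  exact J.mul_mem_left _ ha

theorem monomial_mem_leadingIdeal_iff {k : Type*} [Field k] {n : ℕ} {m : MonomialOrder (Fin n)}
    {I : Ideal (MvPolynomial (Fin n) k)} {a : Fin n →₀ ℕ} :
    monomial a (1 : k) ∈ leadingIdeal m I ↔ ∃ f ∈ I, f ≠ 0 ∧ m.degree f ≤ a := by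
  have hset : {t | ∃ f ∈ I, f ≠ 0 ∧ t = monomial (m.degree f) (1 : k)} =
      (fun s => monomial s (1 : k)) '' {s | ∃ f ∈ I, f ≠ 0 ∧ m.degree f = s} := by
    ext t
    constructor
    · rintro ⟨f, hf, h0, rfl⟩
      exact ⟨_, ⟨f, hf, h0, rfl⟩, rfl⟩
    · rintro ⟨_, ⟨f, hf, h0, rfl⟩, rfl⟩
      exact ⟨f, hf, h0, rfl⟩
  rw [leadingIdeal, hset, mem_ideal_span_monomial_image]
  classical
  simp only [support_monomial, one_ne_zero, if_false, Finset.mem_singleton, forall_eq]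
  constructor
  · rintro ⟨_, ⟨f, hf, h0, rfl⟩, h⟩
    exact ⟨f, hf, h0, h⟩
  · rintro ⟨f, hf, h0, h⟩
    exact ⟨_, ⟨f, hf, h0, rfl⟩, h⟩

/-- If a monomial ideal contains a power of `x_j`, then the smallest such power is a minimal
generator, so its exponent is at most the maximal degree of a minimal generator. -/
theorem monomial_single_maxGeneratorDegree_mem {k : Type*} [Field k] {n : ℕ}
    {J : Ideal (MvPolynomial (Fin n) k)} {j : Fin n} {e : ℕ}
    (h : monomial (Finsupp.single j e) (1 : k) ∈ J) :
    monomial (Finsupp.single j (maxGeneratorDegree J)) (1 : k) ∈ J := by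
  obtain ⟨ν, hle, hν⟩ := exists_minimal_le_of_wellFoundedLT
    (fun ν : Fin n →₀ ℕ => monomial ν (1 : k) ∈ J) _ h
  have hdeg : ν.degree ≤ maxGeneratorDegree J :=
    le_csSup ((finite_minimalExponents J).image _).bddAbove ⟨ν, hν, rfl⟩
  refine monomial_mem_of_le hν.prop fun i => ?_
  by_cases hi : i = j
  · subst hi
    rw [Finsupp.single_eq_same]
    exact (Finsupp.le_degree i ν).trans hdeg
  · have := hle i
    rw [Finsupp.single_eq_of_ne hi] at this
    exact this.trans (Nat.zero_le _)

end Terms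

/-! ### Finiteness and pure powers in the leading ideal -/

section Finiteness

open MvPolynomial

/-- The part of total degree `e` of an integral equation of degree `e` for `x_j` over the last
variables is `x_j ^ e` plus terms involving one of the last variables; these are smaller in the
degree reverse lexicographic order. -/
theorem exists_monomial_single_mem_leadingIdeal_of_finite {k : Type*} [Field k] {n D : ℕ}
    {I : Ideal (MvPolynomial (Fin n) k)}
    (hI : ∀ f ∈ I, ∀ e, homogeneousComponent e f ∈ I)
    (hfin : (lastVariablesMap D I).Finite) {j : Fin n} (hj : j.val + 1 + D ≤ n) :
    ∃ e, monomial (Finsupp.single j e) (1 : k) ∈ leadingIdeal (degRevLex n) I := by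
  classical
  obtain ⟨p, hp, hpe⟩ := RingHom.Finite.to_isIntegral hfin (Ideal.Quotient.mk I (X j))
  set L : MvPolynomial {i : Fin n // n ≤ i.val + D} k →ₐ[k] MvPolynomial (Fin n) k :=
    rename Subtype.val with hL
  set e := p.natDegree with he
  set F : MvPolynomial (Fin n) k := p.eval₂ L.toRingHom (X j) with hF
  have hFI : F ∈ I := by
    rw [← Ideal.Quotient.eq_zero_iff_mem, hF, Polynomial.hom_eval₂]
    exact hpe
  have hFsum : F = ∑ i ∈ Finset.range (e + 1), L (p.coeff i) * monomial (Finsupp.single j i) 1 := by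
    rw [hF, Polynomial.eval₂_eq_sum_range]
    refine Finset.sum_congr rfl fun i _ => ?_
    rw [X_pow_eq_monomial]
    rfl
  -- Only the leading term of the monic equation contributes to the coefficient of `x_j ^ e`.
  have hcoeff : coeff (Finsupp.single j e) F = 1 := by
    rw [hFsum, Finset.sum_range_succ, he, hp.coeff_natDegree, map_one, one_mul, coeff_add,
      coeff_monomial, if_pos rfl, coeff_sum, Finset.sum_eq_zero, zero_add]
    intro i hi
    have hi : i < p.natDegree := Finset.mem_range.1 hi
    rw [coeff_mul_monomial', if_pos (by simpa using hi.le), mul_one, hL]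
    apply coeff_rename_eq_zero
    intro u hu
    exfalso
    -- The exponent of `x_j` in `x_j ^ (e - i)` is positive, while `x_j` is not a last variable.
    have h1 := DFunLike.congr_fun hu j
    rw [Finsupp.mapDomain_of_notMem_range _ _ (by rintro ⟨⟨i, hi'⟩, rfl⟩; simp only at hj; omega)] at h1
    simp at h1
    omega
  have hvars : F ∈ supported k ({j} ∪ {i : Fin n | n ≤ i.val + D}) := by
    rw [hFsum]
    refine sum_mem fun i _ => mul_mem ?_ ?_
    · refine supported_mono Set.subset_union_right ?_
      rw [hL]
      exact (SetLike.ext_iff.1 (supported_eq_range_rename {i : Fin n | n ≤ i.val + D}) _).2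
        ⟨p.coeff i, rfl⟩
    · rw [← X_pow_eq_monomial]
      exact pow_mem (X_mem_supported.2 (by simp)) _
  set G := homogeneousComponent e F with hG
  have hGcoeff : coeff (Finsupp.single j e) G = 1 := by
    rw [hG, coeff_homogeneousComponent, if_pos (by simp), hcoeff]
  have hG0 : G ≠ 0 := by
    rintro h
    rw [h, coeff_zero] at hGcoeff
    exact zero_ne_one hGcoeff
  refine ⟨e, monomial_mem_leadingIdeal_iff.2 ⟨G, hI F hFI e, hG0, le_of_eq ?_⟩⟩
  have hle := (degRevLex n).le_degree (d := Finsupp.single j e) (f := G)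
    (by rw [mem_support_iff, hGcoeff]; exact one_ne_zero)
  have hsupp := (degRevLex n).degree_mem_support hG0
  set a := (degRevLex n).degree G
  rw [mem_support_iff, hG, coeff_homogeneousComponent] at hsupp
  have hadeg : a.degree = e := by
    by_contra h
    exact hsupp (if_neg h)
  rw [if_pos hadeg] at hsupp
  rcases hle.eq_or_lt with h | h
  · exact ((degRevLex n).toSyn.injective h).symm
  · exfalso
    rw [degRevLex_lt_iff] at h
    -- A larger term `x^a` of the same degree has no variable after `x_j`, so it is `x_j ^ e` itself.
    rcases h with h | ⟨-, i, hi, hlt⟩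
    · simp [hadeg] at h
    · have hij : i = j := by
        by_contra hij
        rw [Finsupp.single_eq_of_ne hij] at hlt
        omega
      subst hij
      have ha : a = Finsupp.single i (a i) := by
        ext l
        by_cases hl : l = i
        · simp [hl]
        rw [Finsupp.single_eq_of_ne hl]
        by_contra hal
        have hmem : l ∈ F.vars := (mem_vars_iff_mem_support l).2
          ⟨a, mem_support_iff.2 hsupp, Finsupp.mem_support_iff.2 hal⟩
        have hl' : n ≤ l.val + D := by
          rcases mem_supported.1 hvars hmem with h | h
          · exact absurd h hl
          · exact h
        have := hi l (by rw [Fin.lt_def]; omega)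
        rw [Finsupp.single_eq_of_ne hl] at this
        exact hal this.symm
      rw [ha, Finsupp.degree_single] at hadeg
      rw [Finsupp.single_eq_same] at hlt
      omega

/-- The terms outside the leading ideal span the quotient, and they are products of a term in the
last variables with one of the finitely many terms of bounded exponents in the others. -/
theorem lastVariablesMap_finite_of_monomial_single_mem {k : Type*} [Field k] {n D q : ℕ}
    {m : MonomialOrder (Fin n)} {I : Ideal (MvPolynomial (Fin n) k)}
    (h : ∀ j : Fin n, j.val + 1 + D ≤ n →
      monomial (Finsupp.single j q) (1 : k) ∈ leadingIdeal m I) :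
    (lastVariablesMap D I).Finite := by
  classical
  let A := MvPolynomial {i : Fin n // n ≤ i.val + D} k
  let algA : Algebra A (MvPolynomial (Fin n) k ⧸ I) := (lastVariablesMap D I).toRingHom.toAlgebra
  let modA : Module A (MvPolynomial (Fin n) k ⧸ I) := algA.toModule
  change Module.Finite A _
  set S : Set (MvPolynomial (Fin n) k ⧸ I) :=
    (fun c => Ideal.Quotient.mk I (monomial c 1)) ''
      Set.Iic (Finsupp.equivFunOnFinite.symm fun _ => q)
  have hSfin : S.Finite := (Set.finite_Iic _).image _
  refine ⟨hSfin.toFinset, ?_⟩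
  rw [hSfin.coe_toFinset, eq_top_iff]
  have key : ∀ a : Fin n →₀ ℕ, monomial a (1 : k) ∉ leadingIdeal m I →
      Ideal.Quotient.mk I (monomial a 1) ∈ Submodule.span A S := by
    intro a ha
    have hlt : ∀ j : Fin n, j.val + 1 + D ≤ n → a j < q := by
      intro j hj
      by_contra hq
      exact ha (monomial_mem_of_le (h j hj) (Finsupp.single_le_iff.2 (not_lt.1 hq)))
    set c : Fin n →₀ ℕ := a.filter fun i => i.val + 1 + D ≤ n with hc
    set b := a.subtypeDomain fun i : Fin n => n ≤ i.val + D with hb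
    have hab : b.mapDomain Subtype.val + c = a := by
      ext i
      by_cases hi : n ≤ i.val + D
      · have : Finsupp.mapDomain Subtype.val b i = b ⟨i, hi⟩ :=
          Finsupp.mapDomain_apply Subtype.val_injective b ⟨i, hi⟩
        rw [Finsupp.add_apply, this, hc, Finsupp.filter_apply_neg _ _ (by omega)]
        simp [hb]
      · rw [Finsupp.add_apply, Finsupp.mapDomain_of_notMem_range _ _
          (by rintro ⟨⟨i', hi'⟩, rfl⟩; exact hi hi'), hc,
          Finsupp.filter_apply_pos _ _ (by omega), zero_add]
    have : Ideal.Quotient.mk I (monomial a 1) =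
        (monomial b 1 : A) • Ideal.Quotient.mk I (monomial c 1) := by
      rw [Algebra.smul_def]
      change _ = Ideal.Quotient.mk I (rename Subtype.val (monomial b 1)) * _
      rw [rename_monomial, ← map_mul, monomial_mul, hab, one_mul]
    rw [this]
    refine Submodule.smul_mem _ _ (Submodule.subset_span ⟨c, fun i => ?_, rfl⟩)
    change c i ≤ q
    rw [hc, Finsupp.filter_apply]
    split_ifs with hi
    · exact (hlt i hi).le
    · exact Nat.zero_le _
  intro x _
  obtain ⟨f, rfl⟩ := Ideal.Quotient.mk_surjective x
  -- Division by all nonzero elements of `I` leaves a remainder without terms in the leading ideal.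
  obtain ⟨g, r, hfr, -, hr⟩ := m.div_set (B := {f | f ∈ I ∧ f ≠ 0})
    (fun b hb => MonomialOrder.isUnit_leadingCoeff.2 hb.2) f
  have hmod : Ideal.Quotient.mk I f = Ideal.Quotient.mk I r := by
    rw [Ideal.Quotient.eq, hfr, add_sub_cancel_right, Finsupp.linearCombination_apply]
    exact Submodule.sum_mem _ fun b _ => I.mul_mem_left _ b.2.1
  rw [hmod, r.as_sum, map_sum]
  refine Submodule.sum_mem _ fun a ha => ?_
  have hterm : Ideal.Quotient.mk I (monomial a (coeff a r)) =
      (C (coeff a r) : A) • Ideal.Quotient.mk I (monomial a 1) := by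
    rw [Algebra.smul_def]
    change _ = Ideal.Quotient.mk I (rename Subtype.val (C _)) * _
    rw [rename_C, ← map_mul, C_mul_monomial, mul_one]
  rw [hterm]
  refine Submodule.smul_mem _ _ (key a fun hmem => ?_)
  obtain ⟨f', hf', h0, hle⟩ := monomial_mem_leadingIdeal_iff.1 hmem
  exact hr a ha f' ⟨hf', h0⟩ hle

end Finiteness

/-! ### Pure powers and weak quasi-stability -/

section QuasiStability

open MvPolynomial

/-- Weak quasi-stability replaces the largest variable of a term by a power of `x_j`; repeating
this removes all of the last variables. -/
theorem IsWeaklyQuasiStable.exists_monomial_single_mem {k : Type*} [Field k] {n D : ℕ}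
    {J : Ideal (MvPolynomial (Fin n) k)} (hJ : IsWeaklyQuasiStable D J) {j : Fin n}
    (hj : j.val + 1 + D ≤ n) {μ : Fin n →₀ ℕ} (hμ : monomial μ (1 : k) ∈ J)
    (hsupp : ∀ i, μ i ≠ 0 → i = j ∨ n ≤ i.val + D) :
    ∃ e, monomial (Finsupp.single j e) (1 : k) ∈ J := by
  classical
  induction hN : (μ.support.erase j).card using Nat.strong_induction_on generalizing μ with
  | _ N ih =>
  by_cases hne : (μ.support.erase j).Nonempty
  · obtain ⟨i, hi⟩ := hne
    obtain ⟨hij, hi⟩ := Finset.mem_erase.1 hi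
    have hne : μ.support.Nonempty := ⟨i, hi⟩
    set m := μ.support.max' hne with hm
    have hmmem : m ∈ μ.support := μ.support.max'_mem hne
    have him : i ≤ m := μ.support.le_max' i hi
    have hiD : n ≤ i.val + D := (hsupp i (Finsupp.mem_support_iff.1 hi)).resolve_left hij
    have him' : i.val ≤ m.val := him
    have hjm : j < m := by rw [Fin.lt_def]; omega
    have hgreatest : IsGreatest {i : Fin n | μ i ≠ 0} m :=
      ⟨Finsupp.mem_support_iff.1 hmmem,
        fun l hl => μ.support.le_max' l (Finsupp.mem_support_iff.2 hl)⟩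
    have hnew := hJ μ m j hμ hgreatest (by omega) hjm hj
    set ν := Finsupp.single j (maxGeneratorDegree J) + μ.erase m with hν
    have hνapply : ∀ l, l ≠ j → ν l ≠ 0 → l ≠ m ∧ μ l ≠ 0 := by
      intro l hl h
      rw [hν, Finsupp.add_apply, Finsupp.single_eq_of_ne hl, zero_add] at h
      by_cases hlm : l = m
      · rw [hlm, Finsupp.erase_same] at h
        exact absurd rfl h
      · rw [Finsupp.erase_ne hlm] at h
        exact ⟨hlm, h⟩
    refine ih _ ?_ hnew (fun l hl => ?_) rfl
    · rw [← hN]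
      refine Finset.card_lt_card ((Finset.ssubset_iff_of_subset fun l hl => ?_).2 ⟨m, ?_, ?_⟩)
      · obtain ⟨hlj, hl⟩ := Finset.mem_erase.1 hl
        exact Finset.mem_erase.2 ⟨hlj, Finsupp.mem_support_iff.2
          (hνapply l hlj (Finsupp.mem_support_iff.1 hl)).2⟩
      · exact Finset.mem_erase.2 ⟨hjm.ne', hmmem⟩
      · intro h
        obtain ⟨hlj, hl⟩ := Finset.mem_erase.1 h
        exact (hνapply m hlj (Finsupp.mem_support_iff.1 hl)).1 rfl
    · by_cases hlj : l = j
      · exact Or.inl hlj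
      · exact hsupp l (hνapply l hlj hl).2
  · refine ⟨μ j, ?_⟩
    have : μ = Finsupp.single j (μ j) := by
      ext l
      by_cases hl : l = j
      · simp [hl]
      · rw [Finsupp.single_eq_of_ne hl]
        by_contra h
        exact hne ⟨l, Finset.mem_erase.2 ⟨hl, Finsupp.mem_support_iff.2 h⟩⟩
    rwa [← this]

theorem isWeaklyQuasiStable_of_monomial_single_mem {k : Type*} [Field k] {n D : ℕ}
    {J : Ideal (MvPolynomial (Fin n) k)}
    (h : ∀ j : Fin n, j.val + 1 + D ≤ n → ∃ e, monomial (Finsupp.single j e) (1 : k) ∈ J) :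
    IsWeaklyQuasiStable D J := by
  intro μ m j _ _ _ _ hj
  obtain ⟨e, he⟩ := h j hj
  exact monomial_mem_of_le (monomial_single_maxGeneratorDegree_mem he) le_self_add

/-- The `D + 1` variables consisting of `x_j` and the last `D` ones are dependent modulo an ideal
of dimension `D`, and a dependence has its leading term in these variables. -/
theorem exists_monomial_mem_leadingIdeal_of_ringKrullDim {k : Type*} [Field k] {n D : ℕ}
    {I : Ideal (MvPolynomial (Fin n) k)} (m : MonomialOrder (Fin n))
    (hD : ringKrullDim (MvPolynomial (Fin n) k ⧸ I) = D) {j : Fin n} (hj : j.val + 1 + D ≤ n) :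
    ∃ μ : Fin n →₀ ℕ, monomial μ (1 : k) ∈ leadingIdeal m I ∧
      ∀ i, μ i ≠ 0 → i = j ∨ n ≤ i.val + D := by
  classical
  let v : Option (Fin D) → Fin n := fun o => o.elim j fun t => ⟨n - D + t.val, by omega⟩
  have hv : Function.Injective v := by
    rintro (_ | s) (_ | t) hst
    · rfl
    · have := congrArg Fin.val hst
      simp only [v, Option.elim] at this
      omega
    · have := congrArg Fin.val hst
      simp only [v, Option.elim] at this
      omega
    · have := congrArg Fin.val hst
      simp only [v, Option.elim] at this
      exact congrArg some (Fin.ext (by omega))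
  have hdep : ¬ AlgebraicIndependent k fun o => Ideal.Quotient.mkₐ k I (X (v o)) := by
    intro hind
    have h := natCard_le_ringKrullDim_of_algebraicIndependent hind
    rw [hD] at h
    have h : Nat.card (Option (Fin D)) ≤ D := by exact_mod_cast h
    simp at h
  rw [algebraicIndependent_iff_injective_aeval, injective_iff_map_eq_zero] at hdep
  push Not at hdep
  obtain ⟨f, hf, hf0⟩ := hdep
  have hmem : rename v f ∈ I := by
    rw [← Ideal.Quotient.eq_zero_iff_mem, ← hf, ← Ideal.Quotient.mkₐ_eq_mk k, ← AlgHom.comp_apply]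
    congr 1
    ext o
    simp
  have h0 : rename v f ≠ 0 := fun h => hf0 (rename_injective v hv (by rw [h, map_zero]))
  refine ⟨m.degree (rename v f), monomial_mem_leadingIdeal_iff.2 ⟨_, hmem, h0, le_rfl⟩,
    fun i hi => ?_⟩
  have hvars : i ∈ (rename v f).vars :=
    (mem_vars_iff_mem_support i).2 ⟨_, m.degree_mem_support h0, Finsupp.mem_support_iff.2 hi⟩
  obtain ⟨o, -, rfl⟩ := Finset.mem_image.1 (vars_rename v f hvars)
  rcases o with _ | t
  · exact Or.inl rfl
  · right
    simp only [v, Option.elim]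
    omega

end QuasiStability

/-! ### Noether position and weak quasi-stability -/

theorem mainTheorem2 {k : Type*} [Field k] {n D : ℕ} (I : Ideal (MvPolynomial (Fin n) k))
    (hI : I.IsHomogeneous (MvPolynomial.homogeneousSubmodule (Fin n) k))
    (hD : ringKrullDim (MvPolynomial (Fin n) k ⧸ I) = D) :
    IsInNoetherPosition D I ↔ IsInWeaklyQuasiStablePosition D I := by
  constructor
  · rintro ⟨-, hfin⟩
    exact isWeaklyQuasiStable_of_monomial_single_mem fun j hj =>
      exists_monomial_single_mem_leadingIdeal_of_finite
        (fun f hf e => MvPolynomial.homogeneousComponent_mem_of_mem hI hf e) hfin hj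
  · intro hqs
    have hfin : (lastVariablesMap D I).Finite := by
      refine lastVariablesMap_finite_of_monomial_single_mem (m := degRevLex n)
        (q := maxGeneratorDegree (leadingIdeal (degRevLex n) I)) fun j hj => ?_
      obtain ⟨μ, hμ, hsupp⟩ := exists_monomial_mem_leadingIdeal_of_ringKrullDim (degRevLex n) hD hj
      obtain ⟨e, he⟩ := IsWeaklyQuasiStable.exists_monomial_single_mem hqs hj hμ hsupp
      exact monomial_single_maxGeneratorDegree_mem he
    refine ⟨MvPolynomial.injective_of_isIntegral_of_natCard_le_ringKrullDim
      (f := (lastVariablesMap D I).toRingHom) (RingHom.Finite.to_isIntegral hfin) ?_, hfin⟩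
    have hcard : Nat.card {i : Fin n // n ≤ i.val + D} ≤ D := by
      let u : {i : Fin n // n ≤ i.val + D} → Fin D := fun i => ⟨i.1.val + D - n, by omega⟩
      have hu : Function.Injective u := fun a b hab => by
        have hab : a.1.val + D - n = b.1.val + D - n := congrArg Fin.val hab
        exact Subtype.ext (Fin.ext (by omega))
      exact (Nat.card_le_card_of_injective u hu).trans_eq (Nat.card_fin D)
    rw [hD]
    exact_mod_cast hcard
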